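/- There is an absolute constant $K>0$ with the following property. Let $d,N\ge 1$ be integers, let $C\ge 1$, $\eta>0$, $\varepsilon_N>0$, $\lambda>0$ and $0<\delta<1$, with $\delta\le 1/2$ if $d=1$, and let $\theta\in\mathbb{R}^d$ with $\|\theta\|_2\le 1$. Let $(x_1,b_1,\xi_1),\dots,(x_N,b_N,\xi_N)$ be i.i.d. copies of a random triple $(x,b,\xi)\in\mathbb{R}^d\times\mathbb{R}\times\mathbb{R}$ and let $$y_i=\theta^\top x_i+b_i+\xi_i .$$ Assume that almost surely $\|x\|_2\le 1$, $|b|\le 1$, $|\xi|\le 1$; that $\Pr[b\ne 0]\le\eta$; that $\mathbb{E}[\xi\mid x]=0$; and that $x$ is $(C,4)$-hypercontractive, i.e. $\mathbb{E}[(x^\top v)^4]\le C\,\big(\mathbb{E}[(x^\top v)^2]\big)^2$ for all $v\in\mathbb{R}^d$. Let $$\hat\theta=\Big(\sum_{i=1}^N x_ix_i^\top+N\lambda I\Big)^{-1}\sum_{i=1}^N x_iy_i .$$ If $$N\ \ge\ K\left(\Big(\frac{d}{\varepsilon_N^2}+\frac1\eta\Big)\log\frac d\delta+\frac1\delta\right),$$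 and if moreover $\lambda\ge\varepsilon_N$ or $N\ge K\,C\,d\log(d/\delta)$ (when $\varepsilon_N\le 1$, the latter follows from the displayed condition once $K$ is replaced there by $KC$), then with probability at least $1-\delta$ over the sample $$\mathbb{E}_{x}\Big[\big((\hat\theta-\theta)^\top x\big)^2\Big]\ \le\ 8(\varepsilon_N+\lambda)+288\,\eta^{1.5}C^{2.5}d^{4.5}\delta^{-0.5},$$ where $\mathbb{E}_x$ is over a fresh $x$ independent of the sample. -/

import Mathlib

open MeasureTheory

/-- A distribution `ν` on `ℝ^d` is `(C,4)`-hypercontractive: for every direction `v`, the fourth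
moment of `xᵀ v` is finite and at most `C` times the square of its second moment. -/
def IsHypercontractive {d : ℕ} (C : ℝ) (ν : Measure (EuclideanSpace ℝ (Fin d))) : Prop :=
  ∀ v : EuclideanSpace ℝ (Fin d),
    Integrable (fun x => (inner ℝ x v) ^ 4) ν ∧
      ∫ x, (inner ℝ x v) ^ 4 ∂ν ≤ C * (∫ x, (inner ℝ x v) ^ 2 ∂ν) ^ 2

/-- The ridge regression estimator
`(∑ i, x_i x_iᵀ + N * lam * I)⁻¹ (∑ i, y_i x_i)`.
For `lam > 0` and `N ≥ 1` the matrix is positive definite, so the inverse is the true one. -/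
noncomputable def ridgeEstimator {d N : ℕ} (lam : ℝ) (x : Fin N → EuclideanSpace ℝ (Fin d))
    (y : Fin N → ℝ) : EuclideanSpace ℝ (Fin d) :=
  WithLp.toLp 2
    (Matrix.mulVec
      ((∑ i, Matrix.vecMulVec (x i).ofLp (x i).ofLp) +
        ((N : ℝ) * lam) • (1 : Matrix (Fin d) (Fin d) ℝ))⁻¹
      (∑ i, y i • (x i).ofLp))

/-- The responses `y_i = θᵀ x_i + b_i + ξ_i`, for a sample of triples `z_i = (x_i, b_i, ξ_i)`. -/
noncomputable def response {d N : ℕ} (θ : EuclideanSpace ℝ (Fin d))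
    (z : Fin N → EuclideanSpace ℝ (Fin d) × ℝ × ℝ) (i : Fin N) : ℝ :=
  inner ℝ θ (z i).1 + (z i).2.1 + (z i).2.2

/-- The population risk `E_x [((θ' - θ)ᵀ x)²]`, where `ν` is the law of `x`. -/
noncomputable def excessRisk {d : ℕ} (ν : Measure (EuclideanSpace ℝ (Fin d)))
    (θ' θ : EuclideanSpace ℝ (Fin d)) : ℝ :=
  ∫ x, (inner ℝ (θ' - θ) x) ^ 2 ∂ν

/-! Choose coordinates `T` in which the population form `E⟪x, T u⟫² + λ‖T u‖²` is `‖u‖²`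
(`exists_whitening`). For the error `e = T u` the risk is then at most `‖u‖²`, and the normal
equations tested against `e` say that the regularised empirical form `Q u` equals a corruption term
plus a noise term plus a ridge bias. The corruption is at most `‖u‖` times the average of
`|bᵢ|‖T*xᵢ‖`, the bias at most `‖u‖√λ`.

On a net of the sphere, `Q` is bounded below by a one-sided tail bound that needs only fourth
moments, and the averaged noise `ζ` satisfies `⟪ζ, w⟫ ≤ r (P w / 2 + 1)` with `r = √(L/N)` and `P`
the unregularised empirical form. Since `P ≤ Q`, the noise is absorbed when dividing by `Q`, so no
sharp upper bound on `P` is needed; `norm_le_of_net` turns this into a bound on `‖u‖`. Hölder, a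
count of the corrupted samples and Markov for `‖T*x‖⁴` control the corruption.

The lower bound on `Q` requires `E⟪x, v⟫⁴ ≤ M (E⟪x, v⟫² + λ‖v‖²)²` and `N` of order `M d log(d/δ)`.
Hypercontractivity gives `M = C`; when `λ ≥ ε`, boundedness of `x` gives `M = 1/ε²`. These are the
two alternatives of the theorem. -/

/-! ### Elementary exponential inequalities. -/

theorem Real.exp_neg_le_quadratic {y : ℝ} (hy : 0 ≤ y) :
    Real.exp (-y) ≤ 1 - y + y ^ 2 / 2 := by
  have h1 := Real.quadratic_le_exp_of_nonneg hy
  have h2 : 0 < 1 - y + y ^ 2 / 2 := by nlinarith [sq_nonneg (y - 1)]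
  rw [Real.exp_neg, inv_le_iff_one_le_mul₀ (Real.exp_pos y)]
  calc (1 : ℝ) ≤ (1 - y + y ^ 2 / 2) * (1 + y + y ^ 2 / 2) := by nlinarith [sq_nonneg (y ^ 2)]
    _ ≤ _ := mul_le_mul_of_nonneg_left h1 h2.le

/-- Convexity bounds `exp (a t)` by its chord `cosh a + t sinh a`, and `cosh a ≤ exp (a²/2)`. The
right side is affine in `t`, so a conditionally centred `t` leaves exactly `1` in expectation. -/
theorem Real.exp_mul_sub_half_sq_le (a : ℝ) {t : ℝ} (ht : |t| ≤ 1) :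
    Real.exp (a * t - a ^ 2 / 2) ≤ 1 + t * (Real.sinh a * Real.exp (-(a ^ 2 / 2))) := by
  have h1 := Real.exp_mul_le_cosh_add_mul_sinh ht a
  have h2 := Real.cosh_le_exp_half_sq a
  have h3 := Real.exp_pos (-(a ^ 2 / 2))
  have h4 : Real.exp (a ^ 2 / 2) * Real.exp (-(a ^ 2 / 2)) = 1 := by
    rw [← Real.exp_add]; simp
  have h5 : Real.exp (a * t - a ^ 2 / 2) = Real.exp (t * a) * Real.exp (-(a ^ 2 / 2)) := by
    rw [← Real.exp_add]; congr 1; ring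
  rw [h5]
  nlinarith

theorem Real.abs_sinh_mul_exp_neg_half_sq_le_one (a : ℝ) :
    |Real.sinh a * Real.exp (-(a ^ 2 / 2))| ≤ 1 := by
  have h2 := Real.cosh_le_exp_half_sq a
  have h3 : |Real.sinh a| ≤ Real.cosh a := by
    rw [← Real.cosh_abs a, Real.abs_sinh]; exact (Real.sinh_lt_cosh _).le
  rw [abs_mul, abs_of_pos (Real.exp_pos _), Real.exp_neg, ← div_eq_mul_inv,
    div_le_one (Real.exp_pos _)]
  exact h3.trans h2

/-! ### Tail bounds for sums over an i.i.d. sample. -/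

section Tail

variable {Z : Type*} [MeasurableSpace Z] {D : Measure Z} [IsProbabilityMeasure D]

/-- Chernoff's bound for a sum over an i.i.d. sample. -/
theorem measureReal_pi_le_sum_le_exp {g : Z → ℝ} {c : ℝ}
    (hi : Integrable (fun z => Real.exp (g z)) D) (hc : ∫ z, Real.exp (g z) ∂D ≤ Real.exp c)
    (N : ℕ) (L : ℝ) :
    (Measure.pi fun _ : Fin N => D).real {z | N * c + L ≤ ∑ i, g (z i)} ≤ Real.exp (-L) := by
  have h1 := mul_meas_ge_le_integral_of_nonneg
    (μ := Measure.pi fun _ : Fin N => D) (f := fun z => ∏ i, Real.exp (g (z i)))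
    (ae_of_all _ fun z => Finset.prod_nonneg fun i _ => (Real.exp_pos _).le)
    (Integrable.fintype_prod fun _ => hi) (Real.exp (N * c + L))
  rw [integral_fintype_prod_eq_pow (fun z => Real.exp (g z)), Fintype.card_fin] at h1
  have h2 : {z : Fin N → Z | N * c + L ≤ ∑ i, g (z i)} =
      {z | Real.exp (N * c + L) ≤ ∏ i, Real.exp (g (z i))} := by
    ext z; simp [← Real.exp_sum]
  have h3 : (∫ z, Real.exp (g z) ∂D) ^ N ≤ Real.exp (N * c) := by
    rw [Real.exp_nat_mul]
    exact pow_le_pow_left₀ (integral_nonneg fun z => (Real.exp_pos _).le) hc N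
  rw [h2]
  generalize (Measure.pi fun _ : Fin N => D).real
    {z | Real.exp (N * c + L) ≤ ∏ i, Real.exp (g (z i))} = p at h1 ⊢
  have h4 := h1.trans h3
  rw [Real.exp_add, mul_assoc] at h4
  have h5 := le_of_mul_le_mul_left (h4.trans_eq (mul_one _).symm) (Real.exp_pos _)
  rwa [Real.exp_neg, ← one_div, le_div_iff₀' (Real.exp_pos L)]

/-- Markov's inequality for a sum over an i.i.d. sample. -/
theorem measureReal_pi_le_sum_le_div {g : Z → ℝ} (hg : 0 ≤ᵐ[D] g) (hi : Integrable g D)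
    {N : ℕ} (hN : 0 < N) {c p : ℝ} (hc : ∫ z, g z ∂D ≤ c) (hc0 : 0 < c) (hp : 0 < p) :
    (Measure.pi fun _ : Fin N => D).real {z | N * (c / p) ≤ ∑ i, g (z i)} ≤ p := by
  have hN' : (0 : ℝ) < N := by exact_mod_cast hN
  have h0 : ∀ i : Fin N, 0 ≤ᵐ[Measure.pi fun _ : Fin N => D] fun z => g (z i) := fun i =>
    (measurePreserving_eval (fun _ : Fin N => D) i).quasiMeasurePreserving.ae hg
  have h1 := mul_meas_ge_le_integral_of_nonneg
    (μ := Measure.pi fun _ : Fin N => D) (f := fun z => ∑ i, g (z i))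
    (by filter_upwards [ae_all_iff.2 h0] with z hz using Finset.sum_nonneg fun i _ => hz i)
    (integrable_finsetSum _ fun i _ => integrable_comp_eval (μ := fun _ : Fin N => D) hi)
    (N * (c / p))
  rw [integral_finsetSum _ fun i _ => integrable_comp_eval (μ := fun _ : Fin N => D) hi] at h1
  simp only [integral_comp_eval (μ := fun _ : Fin N => D) hi.aestronglyMeasurable,
    Finset.sum_const, Finset.card_univ, Fintype.card_fin, nsmul_eq_mul] at h1
  have h2 : (N : ℝ) * (c / p) * (Measure.pi fun _ : Fin N => D).real
      {z | N * (c / p) ≤ ∑ i, g (z i)} ≤ N * (c / p) * p := by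
    refine h1.trans ?_
    rw [mul_assoc, div_mul_cancel₀ _ hp.ne']
    gcongr
  exact le_of_mul_le_mul_left h2 (by positivity)

/-- Lower tail of a sum of nonnegative variables in terms of second moments. -/
theorem measureReal_pi_sum_le_le_exp {f : Z → ℝ} (hf : Measurable f) (h0 : ∀ z, 0 ≤ f z)
    (hi : Integrable f D) (hi2 : Integrable (fun z => f z ^ 2) D) {s : ℝ} (hs : 0 < s)
    {V : ℝ} (hV : ∫ z, f z ^ 2 ∂D ≤ V) (N : ℕ) (L : ℝ) :
    (Measure.pi fun _ : Fin N => D).real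
      {z | ∑ i, f (z i) ≤ N * (∫ z, f z ∂D - s * V / 2) - L / s} ≤ Real.exp (-L) := by
  have hie : Integrable (fun z => Real.exp (-(s * f z))) D := by
    refine Integrable.of_bound (by fun_prop) 1 (ae_of_all _ fun z => ?_)
    rw [Real.norm_eq_abs, abs_of_pos (Real.exp_pos _)]
    exact Real.exp_le_one_iff.2 (by have := h0 z; have := mul_nonneg hs.le this; linarith)
  have hc : ∫ z, Real.exp (-(s * f z)) ∂D ≤
      Real.exp (-(s * ∫ z, f z ∂D) + s ^ 2 * V / 2) := by
    -- The quadratic bound on `exp (-y)` holds for every `y ≥ 0`, so `f` need not be bounded.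
    calc ∫ z, Real.exp (-(s * f z)) ∂D ≤ ∫ z, (1 - s * f z + s ^ 2 / 2 * f z ^ 2) ∂D := by
          refine integral_mono hie (((integrable_const _).sub (hi.const_mul s)).add
            (hi2.const_mul _)) fun z => ?_
          have := Real.exp_neg_le_quadratic (mul_nonneg hs.le (h0 z))
          simp only
          linarith
      _ = 1 - s * ∫ z, f z ∂D + s ^ 2 / 2 * ∫ z, f z ^ 2 ∂D := by
          rw [integral_add (f := fun z => 1 - s * f z) ((integrable_const _).sub (hi.const_mul s))
            (hi2.const_mul _), integral_sub (integrable_const _) (hi.const_mul s),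
            integral_const_mul, integral_const_mul]
          simp
      _ ≤ 1 + (-(s * ∫ z, f z ∂D) + s ^ 2 * V / 2) := by
          nlinarith [mul_le_mul_of_nonneg_left hV (sq_nonneg s)]
      _ ≤ _ := by rw [add_comm]; exact Real.add_one_le_exp _
  refine le_trans (measureReal_mono ?_) (measureReal_pi_le_sum_le_exp hie hc N L)
  intro z hz
  simp only [Set.mem_ofPred_eq, Finset.sum_neg_distrib, ← Finset.mul_sum] at hz ⊢
  have := mul_le_mul_of_nonneg_left hz hs.le
  rw [mul_sub, mul_div_cancel₀ _ hs.ne'] at this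
  nlinarith

/-- Upper tail of the number of sample points in a set. -/
theorem measureReal_pi_four_mul_le_sum_indicator {s : Set Z} (hs : MeasurableSet s) {η : ℝ}
    (hη : D.real s ≤ η) (h0 : 0 < η) (N : ℕ) :
    (Measure.pi fun _ : Fin N => D).real
      {z | N * (4 * η) ≤ ∑ i, s.indicator (fun _ => (1 : ℝ)) (z i)} ≤ Real.exp (-(N * η)) := by
  have he : ∀ z, Real.exp (s.indicator (fun _ => (1 : ℝ)) z) =
      1 + (Real.exp 1 - 1) * s.indicator (fun _ => (1 : ℝ)) z := by
    intro z; by_cases h : z ∈ s <;> simp [h]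
  have hii : Integrable (s.indicator fun _ => (1 : ℝ)) D := (integrable_const _).indicator hs
  have hi : Integrable (fun z => Real.exp (s.indicator (fun _ => (1 : ℝ)) z)) D := by
    simp only [he]
    exact (integrable_const _).add (hii.const_mul _)
  have h1 : (0 : ℝ) ≤ Real.exp 1 - 1 := by linarith [Real.add_one_le_exp (1 : ℝ)]
  have hc : ∫ z, Real.exp (s.indicator (fun _ => (1 : ℝ)) z) ∂D ≤
      Real.exp ((Real.exp 1 - 1) * η) := by
    simp only [he]
    rw [integral_add (integrable_const _) (hii.const_mul _), integral_const_mul,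
      integral_indicator_const _ hs]
    simp only [integral_const, probReal_univ, smul_eq_mul, mul_one]
    refine le_trans ?_ (Real.add_one_le_exp _)
    nlinarith [mul_le_mul_of_nonneg_left hη h1]
  -- The threshold is `N (e - 1) η + N η = e N η`, below `4 N η`.
  refine le_trans (measureReal_mono ?_) (measureReal_pi_le_sum_le_exp hi hc N (N * η))
  intro z hz
  simp only [Set.mem_ofPred_eq] at hz ⊢
  refine le_trans ?_ hz
  have := Real.exp_one_lt_d9
  have h3 : 0 ≤ (N : ℝ) * η := by positivity
  nlinarith

end Tail

/-- Self-normalised Hoeffding bound for conditionally centred bounded noise. -/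
theorem measureReal_pi_noise_le_exp {Z : Type*} {m m0 : MeasurableSpace Z} {D : Measure Z}
    [IsProbabilityMeasure D] (hm : m ≤ m0)
    {ξ f : Z → ℝ} (hξ : Measurable ξ) (hb : ∀ᵐ z ∂D, |ξ z| ≤ 1) (h0 : D[ξ | m] =ᵐ[D] 0)
    (hf : Measurable[m] f) (N : ℕ) (L : ℝ) :
    (Measure.pi fun _ : Fin N => D).real
      {z | L ≤ ∑ i, (f (z i) * ξ (z i) - f (z i) ^ 2 / 2)} ≤ Real.exp (-L) := by
  have hf' : Measurable f := hf.mono hm le_rfl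
  have hie : Integrable (fun z => Real.exp (f z * ξ z - f z ^ 2 / 2)) D := by
    refine Integrable.of_bound (by fun_prop) (Real.exp (1 / 2)) ?_
    filter_upwards [hb] with z hz
    rw [Real.norm_eq_abs, abs_of_pos (Real.exp_pos _)]
    refine Real.exp_le_exp.2 ?_
    have := (sq_le_one_iff_abs_le_one _).2 hz
    nlinarith [sq_nonneg (f z - ξ z)]
  have hξi : Integrable ξ D := Integrable.of_bound hξ.aestronglyMeasurable 1 hb
  -- This coefficient of `ξ` is `m`-measurable and bounded by `1`, so `ξ * h` has mean zero with no
  -- integrability assumption on `f`.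
  let h : Z → ℝ := fun z => Real.sinh (f z) * Real.exp (-(f z ^ 2 / 2))
  have hhm : Measurable[m] h :=
    (Real.measurable_sinh.comp hf).mul (Real.measurable_exp.comp ((hf.pow_const 2).div_const 2).neg)
  have hhi : Integrable (ξ * h) D := by
    refine Integrable.of_bound (hξ.mul (hhm.mono hm le_rfl)).aestronglyMeasurable 1 ?_
    filter_upwards [hb] with z hz
    have := Real.abs_sinh_mul_exp_neg_half_sq_le_one (f z)
    simp only [Pi.mul_apply, norm_mul, Real.norm_eq_abs]
    exact mul_le_one₀ hz (abs_nonneg _) this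
  have hint : ∫ z, (ξ * h) z ∂D = 0 := by
    rw [← integral_condExp hm, integral_congr_ae
      (condExp_mul_of_stronglyMeasurable_right hhm.stronglyMeasurable hhi hξi)]
    refine integral_eq_zero_of_ae ?_
    filter_upwards [h0] with z hz
    simp [hz]
  have hc : ∫ z, Real.exp (f z * ξ z - f z ^ 2 / 2) ∂D ≤ Real.exp 0 := by
    calc _ ≤ ∫ z, (1 + (ξ * h) z) ∂D := by
          refine integral_mono_ae hie ((integrable_const _).add hhi) ?_
          filter_upwards [hb] with z hz using Real.exp_mul_sub_half_sq_le (f z) hz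
      _ = _ := by rw [integral_add (integrable_const _) hhi, hint]; simp
  simpa using measureReal_pi_le_sum_le_exp hie hc N L

/-! ### Deterministic linear algebra and the net argument. -/

/-- A symmetric positive definite form on Euclidean space is the squared norm in suitable
linear coordinates. -/
theorem exists_linearEquiv_apply_eq_norm_sq {d : ℕ}
    (B : LinearMap.BilinForm ℝ (EuclideanSpace ℝ (Fin d))) (hs : LinearMap.IsSymm B)
    (hB : ∀ v, v ≠ 0 → 0 < B v v) :
    ∃ T : EuclideanSpace ℝ (Fin d) ≃ₗ[ℝ] EuclideanSpace ℝ (Fin d), ∀ u, B (T u) (T u) = ‖u‖ ^ 2 := by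
  obtain ⟨v', hv'⟩ := LinearMap.BilinForm.exists_orthogonal_basis hs
  let v := v'.reindex (finCongr (finrank_euclideanSpace_fin (𝕜 := ℝ) (n := d)))
  have hv : ∀ i j, i ≠ j → B (v i) (v j) = 0 := fun i j hij => by
    simp only [v, Module.Basis.reindex_apply]
    exact hv' ((Equiv.injective _).ne hij)
  have hpos : ∀ i, 0 < B (v i) (v i) := fun i => hB _ (v.ne_zero i)
  let w := v.isUnitSMul (w := fun i => (√(B (v i) (v i)))⁻¹) fun i =>
    (inv_ne_zero (Real.sqrt_pos.2 (hpos i)).ne').isUnit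
  have hw : ∀ i j, B (w i) (w j) = if i = j then 1 else 0 := fun i j => by
    simp only [w, Module.Basis.isUnitSMul_apply, map_smul, LinearMap.smul_apply, smul_eq_mul]
    split_ifs with h
    · subst h
      have h1 := Real.mul_self_sqrt (hpos i).le
      have h2 := (Real.sqrt_pos.2 (hpos i)).ne'
      field_simp
      nlinarith
    · simp [hv i j h]
  refine ⟨(EuclideanSpace.basisFun (Fin d) ℝ).toBasis.equiv w (Equiv.refl _), fun u => ?_⟩
  have hu : (EuclideanSpace.basisFun (Fin d) ℝ).toBasis.equiv w (Equiv.refl _) u =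
      ∑ i, u i • w i := by
    conv_lhs => rw [← (EuclideanSpace.basisFun (Fin d) ℝ).toBasis.sum_repr u]
    simp only [map_sum, map_smul, Module.Basis.equiv_apply, Equiv.refl_apply]
    rfl
  rw [hu, EuclideanSpace.norm_sq_eq]
  simp only [map_sum, map_smul, LinearMap.sum_apply, LinearMap.smul_apply, hw, smul_eq_mul,
    mul_ite, mul_one, mul_zero]
  simp [sq]

/-- The weak form of the normal equations of ridge regression. -/
theorem ridgeEstimator_normal_eq {d N : ℕ} {lam : ℝ} (hlam : 0 < lam) (hN : 0 < N)
    (x : Fin N → EuclideanSpace ℝ (Fin d)) (y : Fin N → ℝ) (v : EuclideanSpace ℝ (Fin d)) :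
    ∑ i, inner ℝ (x i) (ridgeEstimator lam x y) * inner ℝ (x i) v +
      N * lam * inner ℝ (ridgeEstimator lam x y) v = ∑ i, y i * inner ℝ (x i) v := by
  have hN' : (0 : ℝ) < N := by exact_mod_cast hN
  let G : Matrix (Fin d) (Fin d) ℝ := (∑ i, Matrix.vecMulVec (x i).ofLp (x i).ofLp) +
        ((N : ℝ) * lam) • (1 : Matrix (Fin d) (Fin d) ℝ)
  have hG : G.PosDef := by
    refine Matrix.PosDef.posSemidef_add ?_ (Matrix.PosDef.one.smul (mul_pos hN' hlam))
    refine Matrix.posSemidef_sum _ fun i _ => ?_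
    simpa using Matrix.posSemidef_vecMulVec_self_star (x i).ofLp
  have hdet : IsUnit G.det := (Matrix.isUnit_iff_isUnit_det _).1 hG.isUnit
  have h1 : G.mulVec (ridgeEstimator lam x y).ofLp = ∑ i, y i • (x i).ofLp := by
    show G.mulVec (G⁻¹.mulVec _) = _
    rw [Matrix.mulVec_mulVec, Matrix.mul_nonsing_inv _ hdet, Matrix.one_mulVec]
  have h2 := congrArg (fun w => w ⬝ᵥ v.ofLp) h1
  have hinner : ∀ a b : EuclideanSpace ℝ (Fin d), inner ℝ a b = a.ofLp ⬝ᵥ b.ofLp := fun a b => by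
    rw [EuclideanSpace.inner_eq_star_dotProduct, dotProduct_comm]; simp
  simp only [G, Matrix.add_mulVec, Matrix.sum_mulVec, Matrix.smul_mulVec, Matrix.one_mulVec,
    add_dotProduct, sum_dotProduct, smul_dotProduct, smul_eq_mul,
    Matrix.vecMulVec_mulVec, op_smul_eq_smul] at h2
  simpa [hinner, sum_dotProduct] using h2

/-- The integer grid of mesh `1 / m` is a net of the unit sphere. -/
theorem exists_finset_net (d m : ℕ) (hm : 0 < m) :
    ∃ S : Finset (EuclideanSpace ℝ (Fin d)), S.card ≤ (2 * m + 1) ^ d ∧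
      ∀ w : EuclideanSpace ℝ (Fin d), ‖w‖ = 1 → ∃ w' ∈ S, ‖w' - w‖ ≤ √d / m := by
  classical
  have hm' : (0 : ℝ) < m := by exact_mod_cast hm
  refine ⟨(Fintype.piFinset fun _ : Fin d => Finset.Icc (-m : ℤ) m).image
    fun k => WithLp.toLp 2 fun j => (k j : ℝ) / m, ?_, fun w hw => ?_⟩
  · refine Finset.card_image_le.trans ?_
    rw [Fintype.card_piFinset]
    simp only [Int.card_Icc, Finset.prod_const, Finset.card_univ, Fintype.card_fin]
    gcongr
    omega
  · refine ⟨_, Finset.mem_image_of_mem _ (a := fun j => ⌊m * w j⌋) ?_, ?_⟩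
    · refine Fintype.mem_piFinset.2 fun j => ?_
      have h1 : |w j| ≤ 1 := by
        have := PiLp.norm_apply_le w j
        rwa [hw, Real.norm_eq_abs] at this
      obtain ⟨h2, h3⟩ := abs_le.1 h1
      rw [Finset.mem_Icc]
      constructor
      · rw [Int.le_floor]; push_cast; nlinarith
      · have : (⌊m * w j⌋ : ℝ) ≤ m := (Int.floor_le _).trans (by nlinarith)
        exact_mod_cast this
    · rw [EuclideanSpace.norm_eq]
      have h4 : ∀ j, ‖(WithLp.toLp 2 (fun j => (⌊m * w j⌋ : ℝ) / m) - w : EuclideanSpace ℝ (Fin d)) j‖ ^ 2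
          ≤ (1 / m) ^ 2 := fun j => by
        have h5 : ‖(WithLp.toLp 2 (fun j => (⌊m * w j⌋ : ℝ) / m) - w : EuclideanSpace ℝ (Fin d)) j‖
            ≤ 1 / m := by
          have h6 := Int.floor_le (m * w j)
          have h7 := Int.lt_floor_add_one (m * w j)
          have : (WithLp.toLp 2 (fun j => (⌊m * w j⌋ : ℝ) / m) - w : EuclideanSpace ℝ (Fin d)) j
              = (⌊m * w j⌋ - m * w j) / m := by
            simp; field_simp
          rw [this, Real.norm_eq_abs, abs_div, abs_of_pos hm']
          gcongr
          rw [abs_le]; constructor <;> linarith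
        gcongr
      calc _ ≤ √(∑ j : Fin d, (1 / m : ℝ) ^ 2) := Real.sqrt_le_sqrt (Finset.sum_le_sum fun j _ => h4 j)
        _ = _ := by
          rw [Finset.sum_const, Finset.card_univ, Fintype.card_fin, nsmul_eq_mul,
            Real.sqrt_mul (by positivity), Real.sqrt_sq (by positivity)]
          ring

/-- From lower bounds and self-normalised noise bounds on a net to a bound for every solution
of the perturbed quadratic inequality. `Q` is the regularised empirical form, `P` the empirical
form, `ζ` the averaged noise. -/
theorem norm_le_of_net {E : Type*} [NormedAddCommGroup E] [InnerProductSpace ℝ E]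
    {P Q : E → ℝ} {ζ : E} {S : Set E} {ρ τ r β : ℝ} (hP0 : ∀ w, 0 ≤ P w) (hPQ : ∀ w, P w ≤ Q w)
    (hQs : ∀ w w', Q w' ≤ 11 / 10 * Q w + 11 * Q (w' - w))
    (hQh : ∀ (t : ℝ) w, Q (t • w) = t ^ 2 * Q w)
    (hPt : ∀ w, P w ≤ τ * ‖w‖ ^ 2) (hQt : ∀ w, Q w ≤ (τ + 1) * ‖w‖ ^ 2)
    (hnet : ∀ w, ‖w‖ = 1 → ∃ w' ∈ S, ‖w' - w‖ ≤ ρ)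
    (hlow : ∀ w ∈ S, ‖w‖ ≤ 2 → ‖w‖ ^ 2 - 1 / 50 ≤ Q w)
    (hnoise : ∀ w ∈ S, ‖w‖ ≤ 2 → inner ℝ ζ w ≤ r * (P w / 2 + 1))
    (hρ0 : 0 ≤ ρ) (hρ : ρ ≤ 1 / 1000) (hρτ : ρ * (τ + 1) ≤ 1 / 100) (hτ : 0 ≤ τ) (hr : 0 ≤ r)
    (hβ : 0 ≤ β) {u : E} (hu : Q u ≤ ‖u‖ * β + inner ℝ ζ u) :
    ‖u‖ ≤ 6 / 5 * (β + 2 * r) := by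
  have hn : ∀ w w' : E, ‖w‖ = 1 → ‖w' - w‖ ≤ ρ → 999 / 1000 ≤ ‖w'‖ ∧ ‖w'‖ ≤ 2 := by
    intro w w' hw hww
    have h1 := norm_sub_norm_le w' w
    have h2 := norm_sub_norm_le w w'
    rw [norm_sub_rev] at h2
    constructor <;> linarith
  have hi : ∀ w w' : E, ‖w' - w‖ ≤ ρ → inner ℝ ζ w ≤ inner ℝ ζ w' + ρ * ‖ζ‖ := by
    intro w w' h
    have h1 : inner ℝ ζ w = inner ℝ ζ w' - inner ℝ ζ (w' - w) := by rw [inner_sub_right]; ring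
    have h2 := neg_le_of_abs_le (abs_real_inner_le_norm ζ (w' - w))
    nlinarith [mul_le_mul_of_nonneg_left h (norm_nonneg ζ)]
  -- Testing `ζ` against a net point near its own direction gives the crude bound `‖ζ‖ ≲ 2 r (τ +
  -- 1)`; the smallness of `ρ (τ + 1)` makes the net error harmless.
  have hζ : ρ * ‖ζ‖ ≤ r * (3 / 100) := by
    rcases eq_or_ne ζ 0 with rfl | h0
    · simp; positivity
    have hp : 0 < ‖ζ‖ := norm_pos_iff.2 h0
    have hw : ‖(‖ζ‖⁻¹ • ζ)‖ = 1 := by rw [norm_smul, norm_inv, norm_norm, inv_mul_cancel₀ hp.ne']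
    obtain ⟨w', hS, hw'⟩ := hnet _ hw
    have h1 := hi _ _ hw'
    rw [inner_smul_right, real_inner_self_eq_norm_sq, sq, ← mul_assoc, inv_mul_cancel₀ hp.ne',
      one_mul] at h1
    obtain ⟨_, h2⟩ := hn _ _ hw hw'
    have h3 := hnoise _ hS h2
    have h4 := hPt w'
    have h5 : ‖w'‖ ^ 2 ≤ 4 := by nlinarith [norm_nonneg w']
    have h6 : P w' / 2 + 1 ≤ 2 * (τ + 1) := by nlinarith
    have h7 : ‖ζ‖ ≤ r * (2 * (τ + 1)) + ρ * ‖ζ‖ := by nlinarith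
    have h8 : ‖ζ‖ * (999 / 1000) ≤ r * (2 * (τ + 1)) := by nlinarith
    have h9 := mul_le_mul_of_nonneg_left h8 hρ0
    nlinarith [mul_le_mul_of_nonneg_left hρτ hr]
  rcases eq_or_ne u 0 with rfl | h0
  · simp; positivity
  have hp : 0 < ‖u‖ := norm_pos_iff.2 h0
  have hw : ‖(‖u‖⁻¹ • u)‖ = 1 := by rw [norm_smul, norm_inv, norm_norm, inv_mul_cancel₀ hp.ne']
  obtain ⟨w, hwe⟩ : ∃ w, w = ‖u‖⁻¹ • u := ⟨_, rfl⟩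
  rw [← hwe] at hw
  have hue : u = ‖u‖ • w := by rw [hwe, smul_smul, mul_inv_cancel₀ hp.ne', one_smul]
  obtain ⟨w', hS, hw'⟩ := hnet _ hw
  obtain ⟨h1, h2⟩ := hn _ _ hw hw'
  have h3 := hlow _ hS h2
  have h4 := hQs w w'
  have h5 : Q (w' - w) ≤ 1 / 100000 := by
    refine (hQt _).trans ?_
    have : ‖w' - w‖ ^ 2 ≤ ρ ^ 2 := by gcongr
    nlinarith
  -- From `0.999² - 1/50 ≤ Q w' ≤ 1.1 Q w + 11/100000`.
  have h6 : (88 : ℝ) / 100 ≤ Q w := by nlinarith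
  have h7 := hnoise _ hS h2
  have h8 := hi _ _ hw'
  -- Because `Q w` is bounded below, the constant `1` in the noise bound and the net errors also
  -- become multiples of `Q w`.
  have h9 : inner ℝ ζ w ≤ r * (Q w * (9 / 5)) := by
    have : P w' / 2 + 1 + 3 / 100 ≤ Q w * (9 / 5) := by nlinarith [hPQ w']
    nlinarith [mul_le_mul_of_nonneg_left this hr]
  have h10 : ‖u‖ * Q w ≤ β + inner ℝ ζ w := by
    rw [hue, hQh, inner_smul_right, norm_smul, hw, norm_norm, mul_one] at hu
    have : ‖u‖ * (‖u‖ * Q w) ≤ ‖u‖ * (β + inner ℝ ζ w) := by nlinarith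
    exact le_of_mul_le_mul_left this hp
  have h11 : β ≤ 6 / 5 * β * Q w := by nlinarith
  have h12 : ‖u‖ * Q w ≤ 6 / 5 * (β + 2 * r) * Q w := by
    nlinarith [mul_nonneg hr (hP0 w |>.trans (hPQ w))]
  exact le_of_mul_le_mul_right h12 (by linarith)

theorem one_sub_le_measureReal_of_ae {Ω : Type*} [MeasurableSpace Ω] {μ : Measure Ω}
    [IsProbabilityMeasure μ] {G B : Set Ω} {δ : ℝ} (h : ∀ᵐ z ∂μ, z ∉ B → z ∈ G)
    (hB : μ.real B ≤ δ) : 1 - δ ≤ μ.real G := by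
  have h1 : μ Set.univ ≤ μ (G ∪ B) := measure_mono_ae (by
    filter_upwards [h] with z hz _
    by_cases hb : z ∈ B
    exacts [Or.inr hb, Or.inl (hz hb)])
  have h2 : μ.real Set.univ ≤ μ.real (G ∪ B) := ENNReal.toReal_mono (measure_ne_top _ _) h1
  have h3 := measureReal_union_le (μ := μ) G B
  rw [probReal_univ] at h2
  linarith

/-! ### Moments of the features in whitened coordinates. -/

section Moments

variable {Z : Type*} [MeasurableSpace Z] {D : Measure Z} {d : ℕ}
  {x : Z → EuclideanSpace ℝ (Fin d)}

theorem ae_abs_inner_le (hb : ∀ᵐ z ∂D, ‖x z‖ ≤ 1) (v : EuclideanSpace ℝ (Fin d)) :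
    ∀ᵐ z ∂D, |inner ℝ (x z) v| ≤ ‖v‖ := by
  filter_upwards [hb] with z hz
  exact (abs_real_inner_le_norm _ _).trans (mul_le_of_le_one_left (norm_nonneg _) hz)

variable [IsProbabilityMeasure D]

theorem integrable_inner_pow (hx : Measurable x) (hb : ∀ᵐ z ∂D, ‖x z‖ ≤ 1)
    (v : EuclideanSpace ℝ (Fin d)) (k : ℕ) : Integrable (fun z => inner ℝ (x z) v ^ k) D := by
  refine Integrable.of_bound (by fun_prop) (‖v‖ ^ k) ?_
  filter_upwards [ae_abs_inner_le hb v] with z hz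
  rw [norm_pow, Real.norm_eq_abs]
  gcongr

theorem integrable_inner_mul_inner (hx : Measurable x) (hb : ∀ᵐ z ∂D, ‖x z‖ ≤ 1)
    (u v : EuclideanSpace ℝ (Fin d)) :
    Integrable (fun z => inner ℝ (x z) u * inner ℝ (x z) v) D := by
  refine Integrable.of_bound (by fun_prop) (‖u‖ * ‖v‖) ?_
  filter_upwards [ae_abs_inner_le hb u, ae_abs_inner_le hb v] with z hu hv
  rw [norm_mul, Real.norm_eq_abs, Real.norm_eq_abs]
  gcongr

/-- Whitening of the regularised second moment form. -/
theorem exists_whitening (hx : Measurable x) (hb : ∀ᵐ z ∂D, ‖x z‖ ≤ 1) {lam : ℝ}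
    (hlam : 0 < lam) :
    ∃ T : EuclideanSpace ℝ (Fin d) ≃ₗ[ℝ] EuclideanSpace ℝ (Fin d),
      ∀ u, ∫ z, inner ℝ (x z) (T u) ^ 2 ∂D + lam * ‖T u‖ ^ 2 = ‖u‖ ^ 2 := by
  have hi := integrable_inner_mul_inner (D := D) hx hb
  let B : LinearMap.BilinForm ℝ (EuclideanSpace ℝ (Fin d)) := LinearMap.mk₂ ℝ
    (fun u v => ∫ z, inner ℝ (x z) u * inner ℝ (x z) v ∂D + lam * inner ℝ u v)
    (fun u u' v => by
      simp only [inner_add_right, inner_add_left, add_mul]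
      rw [integral_add (hi u v) (hi u' v)]; ring)
    (fun c u v => by
      simp only [inner_smul_right, inner_smul_left, mul_assoc, integral_const_mul, smul_eq_mul]
      simp; ring)
    (fun u v v' => by
      simp only [inner_add_right, mul_add]
      rw [integral_add (hi u v) (hi u v')]; ring)
    (fun c u v => by
      simp only [inner_smul_right, mul_left_comm _ c, integral_const_mul, smul_eq_mul]
      ring)
  have hB : ∀ u v, B u v = ∫ z, inner ℝ (x z) u * inner ℝ (x z) v ∂D + lam * inner ℝ u v :=
    fun _ _ => rfl
  have hBB : ∀ u, B u u = ∫ z, inner ℝ (x z) u ^ 2 ∂D + lam * ‖u‖ ^ 2 := fun u => by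
    rw [hB, real_inner_self_eq_norm_sq]; simp only [sq]
  obtain ⟨T, hT⟩ := exists_linearEquiv_apply_eq_norm_sq B
    ⟨fun u v => by
      simp only [hB, RingHom.id_apply, real_inner_comm v u, mul_comm (inner ℝ (x _) u)]⟩
    (fun v hv => by
      rw [hBB]
      have h1 : 0 ≤ ∫ z, inner ℝ (x z) v ^ 2 ∂D := integral_nonneg fun z => sq_nonneg _
      have h2 := norm_pos_iff.2 hv
      positivity)
  exact ⟨T, fun u => by rw [← hBB, hT]⟩

theorem norm_sq_adjoint (T : EuclideanSpace ℝ (Fin d) →ₗ[ℝ] EuclideanSpace ℝ (Fin d))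
    (x : EuclideanSpace ℝ (Fin d)) :
    ‖T.adjoint x‖ ^ 2 = ∑ j, inner ℝ x (T (EuclideanSpace.basisFun (Fin d) ℝ j)) ^ 2 := by
  rw [← OrthonormalBasis.sum_sq_norm_inner_right (EuclideanSpace.basisFun (Fin d) ℝ)]
  refine Finset.sum_congr rfl fun j _ => ?_
  rw [LinearMap.adjoint_inner_right, real_inner_comm, Real.norm_eq_abs, sq_abs]

/-- The squared norm is a sum of `d` coordinate terms, each of mean at most `1`. It controls the
trace of the empirical form. -/
theorem integral_norm_sq_adjoint_le (hx : Measurable x) (hb : ∀ᵐ z ∂D, ‖x z‖ ≤ 1)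
    {T : EuclideanSpace ℝ (Fin d) →ₗ[ℝ] EuclideanSpace ℝ (Fin d)}
    (hT : ∀ u, ∫ z, inner ℝ (x z) (T u) ^ 2 ∂D ≤ ‖u‖ ^ 2) :
    Integrable (fun z => ‖T.adjoint (x z)‖ ^ 2) D ∧ ∫ z, ‖T.adjoint (x z)‖ ^ 2 ∂D ≤ d := by
  simp only [norm_sq_adjoint]
  have hi := fun u => integrable_inner_pow (D := D) hx hb u 2
  refine ⟨integrable_finsetSum _ fun j _ => hi _, ?_⟩
  rw [integral_finsetSum _ fun j _ => hi _]
  refine (Finset.sum_le_sum fun j _ => hT _).trans ?_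
  simp

/-- Cauchy–Schwarz over the coordinates costs one factor `d`; summing `d` coordinate fourth moments,
each at most `C`, gives the other. -/
theorem integral_norm_pow_four_adjoint_le (hx : Measurable x) (hb : ∀ᵐ z ∂D, ‖x z‖ ≤ 1)
    {T : EuclideanSpace ℝ (Fin d) →ₗ[ℝ] EuclideanSpace ℝ (Fin d)} {C : ℝ}
    (hT : ∀ u, ∫ z, inner ℝ (x z) (T u) ^ 4 ∂D ≤ C * ‖u‖ ^ 4) :
    Integrable (fun z => ‖T.adjoint (x z)‖ ^ 4) D ∧
      ∫ z, ‖T.adjoint (x z)‖ ^ 4 ∂D ≤ C * d ^ 2 := by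
  have hp : ∀ z, ‖T.adjoint (x z)‖ ^ 4 ≤
      d * ∑ j, inner ℝ (x z) (T (EuclideanSpace.basisFun (Fin d) ℝ j)) ^ 4 := fun z => by
    have h1 := sq_sum_le_card_mul_sum_sq (s := Finset.univ)
      (f := fun j => inner ℝ (x z) (T (EuclideanSpace.basisFun (Fin d) ℝ j)) ^ 2)
    rw [← norm_sq_adjoint] at h1
    simpa [← pow_mul] using h1
  have hi := fun u => integrable_inner_pow (D := D) hx hb u 4
  have hs : Integrable (fun z => (d : ℝ) *
      ∑ j, inner ℝ (x z) (T (EuclideanSpace.basisFun (Fin d) ℝ j)) ^ 4) D :=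
    (integrable_finsetSum _ fun j _ => hi _).const_mul _
  have hc : Continuous T.adjoint := LinearMap.continuous_of_finiteDimensional _
  have hm : Measurable fun z => T.adjoint (x z) := hc.measurable.comp hx
  have hI : Integrable (fun z => ‖T.adjoint (x z)‖ ^ 4) D :=
    hs.mono' (by fun_prop) (ae_of_all _ fun z => by
      rw [Real.norm_of_nonneg (by positivity)]; exact hp z)
  refine ⟨hI, (integral_mono hI hs hp).trans ?_⟩
  rw [integral_const_mul, integral_finsetSum _ fun j _ => hi _]
  have : ∑ j, ∫ z, inner ℝ (x z) (T (EuclideanSpace.basisFun (Fin d) ℝ j)) ^ 4 ∂D ≤ d * C :=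
    (Finset.sum_le_sum fun j _ => hT _).trans (by simp)
  nlinarith [mul_le_mul_of_nonneg_left this d.cast_nonneg]

end Moments

/-! ### Deterministic error analysis of the estimator. -/

/-- The averaged contribution of sparse bounded corruptions. -/
theorem avg_abs_mul_pow_four_le {N : ℕ} (b g : Fin N → ℝ) (hb : ∀ i, |b i| ≤ 1)
    (hg : ∀ i, 0 ≤ g i) :
    ((N : ℝ)⁻¹ * ∑ i, |b i| * g i) ^ 4 ≤
      ((N : ℝ)⁻¹ * ∑ i, if b i ≠ 0 then 1 else 0) ^ 3 * ((N : ℝ)⁻¹ * ∑ i, g i ^ 4) := by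
  let c : Fin N → ℝ := fun i => if b i ≠ 0 then 1 else 0
  have hc : ∀ i, c i ^ 2 = c i := fun i => by by_cases h : b i = 0 <;> simp [c, h]
  have hc0 : ∀ i, 0 ≤ c i := fun i => by by_cases h : b i = 0 <;> simp [c, h]
  have h1 : ∑ i, |b i| * g i ≤ ∑ i, c i * g i := Finset.sum_le_sum fun i _ => by
    by_cases h : b i = 0
    · simp [c, h]
    · simpa [c, h] using mul_le_of_le_one_left (hg i) (hb i)
  have h0 : 0 ≤ ∑ i, |b i| * g i := Finset.sum_nonneg fun i _ => mul_nonneg (abs_nonneg _) (hg i)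
  -- Hölder with exponents `4/3` and `4`, as two Cauchy–Schwarz steps; idempotence of the indicator
  -- `c` keeps it available for the second.
  have h2 : (∑ i, c i * g i) ^ 2 ≤ (∑ i, c i) * ∑ i, c i * g i ^ 2 := by
    have := Finset.sum_mul_sq_le_sq_mul_sq Finset.univ c fun i => c i * g i
    simpa only [mul_pow, hc, ← mul_assoc, ← sq] using this
  have h3 : (∑ i, c i * g i ^ 2) ^ 2 ≤ (∑ i, c i) * ∑ i, g i ^ 4 := by
    have := Finset.sum_mul_sq_le_sq_mul_sq Finset.univ c fun i => g i ^ 2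
    simpa only [hc, ← pow_mul] using this
  have h4 : 0 ≤ ∑ i, c i := Finset.sum_nonneg fun i _ => hc0 i
  have h5 : (∑ i, |b i| * g i) ^ 4 ≤ (∑ i, c i) ^ 3 * ∑ i, g i ^ 4 := by
    calc _ ≤ (∑ i, c i * g i) ^ 4 := by gcongr
      _ = ((∑ i, c i * g i) ^ 2) ^ 2 := by ring
      _ ≤ ((∑ i, c i) * ∑ i, c i * g i ^ 2) ^ 2 := by gcongr
      _ = (∑ i, c i) ^ 2 * (∑ i, c i * g i ^ 2) ^ 2 := by ring
      _ ≤ (∑ i, c i) ^ 2 * ((∑ i, c i) * ∑ i, g i ^ 4) := by gcongr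
      _ = _ := by ring
  calc _ = ((N : ℝ)⁻¹) ^ 4 * (∑ i, |b i| * g i) ^ 4 := by ring
    _ ≤ ((N : ℝ)⁻¹) ^ 4 * ((∑ i, c i) ^ 3 * ∑ i, g i ^ 4) := by gcongr
    _ = _ := by ring

/-- The normal equations in terms of the error of the ridge estimator. -/
theorem ridgeEstimator_error_eq {d N : ℕ} {lam : ℝ} (hlam : 0 < lam) (hN : 0 < N)
    (θ : EuclideanSpace ℝ (Fin d)) (z : Fin N → EuclideanSpace ℝ (Fin d) × ℝ × ℝ)
    {e : EuclideanSpace ℝ (Fin d)}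
    (he : e = ridgeEstimator lam (fun i => (z i).1) (response θ z) - θ) :
    (N : ℝ)⁻¹ * ∑ i, inner ℝ (z i).1 e ^ 2 + lam * ‖e‖ ^ 2 =
      (N : ℝ)⁻¹ * ∑ i, (z i).2.1 * inner ℝ (z i).1 e +
        (N : ℝ)⁻¹ * ∑ i, (z i).2.2 * inner ℝ (z i).1 e - lam * inner ℝ θ e := by
  have hN' : (N : ℝ) ≠ 0 := by exact_mod_cast hN.ne'
  have h := ridgeEstimator_normal_eq hlam hN (fun i => (z i).1) (response θ z) e
  have hr : ridgeEstimator lam (fun i => (z i).1) (response θ z) = e + θ := by rw [he]; abel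
  rw [hr] at h
  have h1 : ∀ i, response θ z i * inner ℝ (z i).1 e = inner ℝ (z i).1 θ * inner ℝ (z i).1 e +
      (z i).2.1 * inner ℝ (z i).1 e + (z i).2.2 * inner ℝ (z i).1 e := fun i => by
    simp only [response, real_inner_comm θ]; ring
  simp only [h1, inner_add_right, inner_add_left, add_mul, Finset.sum_add_distrib, ← sq,
    real_inner_self_eq_norm_sq] at h
  have h2 := congrArg (fun t => (N : ℝ)⁻¹ * t) h
  simp only [mul_add, ← mul_assoc, inv_mul_cancel₀ hN', one_mul] at h2
  linarith

/-- Without any statistics, the error is bounded when the regularisation is at least one. -/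
theorem ridgeEstimator_error_norm_le_three {d N : ℕ} {lam : ℝ} (hlam : 1 ≤ lam) (hN : 0 < N)
    {θ : EuclideanSpace ℝ (Fin d)} (hθ : ‖θ‖ ≤ 1)
    (z : Fin N → EuclideanSpace ℝ (Fin d) × ℝ × ℝ) (hx : ∀ i, ‖(z i).1‖ ≤ 1)
    (hb : ∀ i, |(z i).2.1| ≤ 1) (hξ : ∀ i, |(z i).2.2| ≤ 1) :
    ‖ridgeEstimator lam (fun i => (z i).1) (response θ z) - θ‖ ≤ 3 := by
  obtain ⟨e, he⟩ : ∃ e, e = ridgeEstimator lam (fun i => (z i).1) (response θ z) - θ := ⟨_, rfl⟩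
  have hN' : (0 : ℝ) < N := by exact_mod_cast hN
  have h := ridgeEstimator_error_eq (by linarith) hN θ z he
  rw [← he]
  have havg : ∀ c : Fin N → ℝ, (∀ i, |c i| ≤ 1) →
      (N : ℝ)⁻¹ * ∑ i, c i * inner ℝ (z i).1 e ≤ ‖e‖ := fun c hc => by
    rw [inv_mul_le_iff₀ hN']
    calc ∑ i, c i * inner ℝ (z i).1 e ≤ ∑ i : Fin N, ‖e‖ := Finset.sum_le_sum fun i _ => by
          refine (le_abs_self _).trans ?_
          rw [abs_mul]
          refine (mul_le_of_le_one_left (abs_nonneg _) (hc i)).trans ?_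
          exact (abs_real_inner_le_norm _ _).trans (mul_le_of_le_one_left (norm_nonneg _) (hx i))
      _ = _ := by simp
  have h1 := havg _ hb
  have h2 := havg _ hξ
  have h3 : -inner ℝ θ e ≤ ‖e‖ := (neg_le_abs _).trans
    ((abs_real_inner_le_norm _ _).trans (mul_le_of_le_one_left (norm_nonneg _) hθ))
  have h4 : 0 ≤ (N : ℝ)⁻¹ * ∑ i, inner ℝ (z i).1 e ^ 2 := by positivity
  rcases (norm_nonneg e).eq_or_lt with h0 | h0
  · linarith
  -- Cancelling `‖e‖` leaves `λ‖e‖ ≤ 2 + λ ≤ 3λ`, which uses `1 ≤ λ`.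
  have h5 : ‖e‖ * (lam * ‖e‖) ≤ ‖e‖ * (2 + lam) := by nlinarith
  have h6 := le_of_mul_le_mul_left h5 h0
  nlinarith

/-- The error of the ridge estimator in whitened coordinates, from estimates on a net. -/
theorem ridgeEstimator_error_whitened_le {d N : ℕ} {lam : ℝ} (hlam : 0 < lam) (hN : 0 < N)
    {θ : EuclideanSpace ℝ (Fin d)} (hθ : ‖θ‖ ≤ 1)
    (z : Fin N → EuclideanSpace ℝ (Fin d) × ℝ × ℝ)
    (T : EuclideanSpace ℝ (Fin d) ≃ₗ[ℝ] EuclideanSpace ℝ (Fin d))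
    (hT : ∀ u, lam * ‖T u‖ ^ 2 ≤ ‖u‖ ^ 2) {S : Set (EuclideanSpace ℝ (Fin d))} {ρ τ r : ℝ}
    (hnet : ∀ w, ‖w‖ = 1 → ∃ w' ∈ S, ‖w' - w‖ ≤ ρ)
    (hlow : ∀ w ∈ S, ‖w‖ ≤ 2 → ‖w‖ ^ 2 - 1 / 50 ≤
      (N : ℝ)⁻¹ * ∑ i, inner ℝ (z i).1 (T w) ^ 2 + lam * ‖T w‖ ^ 2)
    (hnoise : ∀ w ∈ S, ‖w‖ ≤ 2 → (N : ℝ)⁻¹ * ∑ i, (z i).2.2 * inner ℝ (z i).1 (T w) ≤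
      r * ((N : ℝ)⁻¹ * (∑ i, inner ℝ (z i).1 (T w) ^ 2) / 2 + 1))
    (htr : (N : ℝ)⁻¹ * ∑ i, ‖T.toLinearMap.adjoint (z i).1‖ ^ 2 ≤ τ)
    (hρ0 : 0 ≤ ρ) (hρ : ρ ≤ 1 / 1000) (hρτ : ρ * (τ + 1) ≤ 1 / 100) (hr : 0 ≤ r) :
    ‖T.symm (ridgeEstimator lam (fun i => (z i).1) (response θ z) - θ)‖ ≤
      6 / 5 * ((N : ℝ)⁻¹ * ∑ i, |(z i).2.1| * ‖T.toLinearMap.adjoint (z i).1‖ + √lam + 2 * r) := by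
  obtain ⟨e, he⟩ : ∃ e, e = ridgeEstimator lam (fun i => (z i).1) (response θ z) - θ := ⟨_, rfl⟩
  rw [← he]
  have hN' : (0 : ℝ) < N := by exact_mod_cast hN
  have hX : ∀ i w, inner ℝ (z i).1 (T w) = inner ℝ (T.toLinearMap.adjoint (z i).1) w := fun i w => by
    rw [LinearMap.adjoint_inner_left]; rfl
  have hP : ∀ w, (N : ℝ)⁻¹ * ∑ i, inner ℝ (z i).1 (T w) ^ 2 ≤ τ * ‖w‖ ^ 2 := fun w => by
    calc _ ≤ (N : ℝ)⁻¹ * ∑ i, ‖T.toLinearMap.adjoint (z i).1‖ ^ 2 * ‖w‖ ^ 2 := by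
          gcongr with i
          rw [hX, ← mul_pow]
          exact sq_le_sq' (neg_le_of_abs_le (abs_real_inner_le_norm _ _)) (real_inner_le_norm _ _)
      _ = ((N : ℝ)⁻¹ * ∑ i, ‖T.toLinearMap.adjoint (z i).1‖ ^ 2) * ‖w‖ ^ 2 := by
          rw [← Finset.sum_mul, mul_assoc]
      _ ≤ _ := by gcongr
  have hζ : ∀ w, inner ℝ ((N : ℝ)⁻¹ • ∑ i, (z i).2.2 • T.toLinearMap.adjoint (z i).1) w =
      (N : ℝ)⁻¹ * ∑ i, (z i).2.2 * inner ℝ (z i).1 (T w) := fun w => by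
    simp only [hX, real_inner_smul_left, sum_inner]
  refine norm_le_of_net (P := fun w => (N : ℝ)⁻¹ * ∑ i, inner ℝ (z i).1 (T w) ^ 2)
    (Q := fun w => (N : ℝ)⁻¹ * ∑ i, inner ℝ (z i).1 (T w) ^ 2 + lam * ‖T w‖ ^ 2)
    (ζ := (N : ℝ)⁻¹ • ∑ i, (z i).2.2 • T.toLinearMap.adjoint (z i).1)
    (fun w => by positivity) (fun w => le_add_of_nonneg_right (by positivity)) ?_ ?_ hP ?_
    hnet hlow (fun w hw hw2 => by rw [hζ]; exact hnoise w hw hw2) hρ0 hρ hρτ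
    (le_trans (by positivity) htr) hr (by positivity) ?_
  · intro w w'
    have h1 : ∀ i, inner ℝ (z i).1 (T w') ^ 2 ≤ 11 / 10 * inner ℝ (z i).1 (T w) ^ 2 +
        11 * inner ℝ (z i).1 (T (w' - w)) ^ 2 := fun i => by
      rw [map_sub, inner_sub_right]
      nlinarith [sq_nonneg (inner ℝ (z i).1 (T w) -
        10 * (inner ℝ (z i).1 (T w') - inner ℝ (z i).1 (T w)))]
    have h2 : ‖T w'‖ ^ 2 ≤ 11 / 10 * ‖T w‖ ^ 2 + 11 * ‖T (w' - w)‖ ^ 2 := by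
      have h3 : ‖T w'‖ ≤ ‖T w‖ + ‖T (w' - w)‖ := by
        have := norm_add_le (T w) (T (w' - w))
        rwa [← map_add, add_sub_cancel] at this
      nlinarith [sq_nonneg (‖T w‖ - 10 * ‖T (w' - w)‖), norm_nonneg (T w')]
    have h4 := Finset.sum_le_sum fun i (_ : i ∈ Finset.univ) => h1 i
    rw [Finset.sum_add_distrib, ← Finset.mul_sum, ← Finset.mul_sum] at h4
    have h5 := mul_le_mul_of_nonneg_left h4 (inv_nonneg.2 hN'.le)
    have h6 := mul_le_mul_of_nonneg_left h2 hlam.le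
    linarith
  · intro t w
    simp only [map_smul, inner_smul_right, norm_smul, mul_pow, ← Finset.mul_sum, Real.norm_eq_abs,
      sq_abs]
    ring
  · intro w
    have := hP w
    have := hT w
    linarith
  · rw [hζ]
    simp only [LinearEquiv.apply_symm_apply]
    have h := ridgeEstimator_error_eq hlam hN θ z he
    have h1 : (N : ℝ)⁻¹ * ∑ i, (z i).2.1 * inner ℝ (z i).1 e ≤
        ‖T.symm e‖ * ((N : ℝ)⁻¹ * ∑ i, |(z i).2.1| * ‖T.toLinearMap.adjoint (z i).1‖) := by
      rw [mul_left_comm]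
      refine mul_le_mul_of_nonneg_left ?_ (inv_nonneg.2 hN'.le)
      rw [Finset.mul_sum]
      refine Finset.sum_le_sum fun i _ => ?_
      refine (le_abs_self _).trans ?_
      rw [abs_mul, mul_left_comm, mul_comm ‖T.symm e‖]
      have := abs_real_inner_le_norm (T.toLinearMap.adjoint (z i).1) (T.symm e)
      rw [← hX, LinearEquiv.apply_symm_apply] at this
      exact mul_le_mul_of_nonneg_left this (abs_nonneg _)
    -- Whitening gives `√λ ‖e‖ ≤ ‖T⁻¹e‖`, so half of the factor `λ` is spent on passing to whitened
    -- coordinates.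
    have h2 : -(lam * inner ℝ θ e) ≤ ‖T.symm e‖ * √lam := by
      have h3 : -inner ℝ θ e ≤ ‖e‖ := (neg_le_abs _).trans
        ((abs_real_inner_le_norm _ _).trans (mul_le_of_le_one_left (norm_nonneg _) hθ))
      have h4 : √lam * ‖e‖ ≤ ‖T.symm e‖ := by
        have h5 := hT (T.symm e)
        rw [LinearEquiv.apply_symm_apply] at h5
        refine le_of_sq_le_sq ?_ (norm_nonneg _)
        rwa [mul_pow, Real.sq_sqrt hlam.le]
      have h6 := Real.mul_self_sqrt hlam.le
      calc -(lam * inner ℝ θ e) = lam * -inner ℝ θ e := by ring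
        _ ≤ lam * ‖e‖ := by gcongr
        _ = √lam * (√lam * ‖e‖) := by rw [← mul_assoc, h6]
        _ ≤ √lam * ‖T.symm e‖ := by gcongr
        _ = _ := mul_comm _ _
    linarith

/-! ### Numerical estimates for the net and the corruption term. -/

/-- The size of the net is negligible against the exponential deviation bounds. -/
theorem net_card_mul_exp_neg_le {d : ℕ} (hd : 0 < d) {δ : ℝ} (hδ : 0 < δ) (h2 : 2 * δ ≤ d)
    {n m : ℕ} (hm : (m : ℝ) ≤ 1001 * (d / δ) ^ 2) (hn : n ≤ (2 * m + 1) ^ d) :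
    n * (2 * Real.exp (-(20 * d * Real.log (d / δ)))) ≤ δ / 4 := by
  have hd1 : (1 : ℝ) ≤ d := by exact_mod_cast hd
  obtain ⟨a, ha⟩ : ∃ a : ℝ, a = d / δ := ⟨_, rfl⟩
  rw [← ha] at hm ⊢
  have ha2 : 2 ≤ a := by rw [ha, le_div_iff₀ hδ]; exact h2
  have ha0 : 0 < a := by linarith
  have had : 1 ≤ a * δ := by rw [ha, div_mul_cancel₀ _ hδ.ne']; exact hd1
  have he : Real.exp (-(20 * d * Real.log a)) = (a ^ (20 * d))⁻¹ := by
    rw [Real.exp_neg]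
    congr 1
    rw [← Real.exp_log (pow_pos ha0 (20 * d)), Real.log_pow]
    push_cast; rfl
  have h11 : (2 : ℝ) ^ 11 ≤ a ^ 11 := by gcongr
  have h3 : (2 : ℝ) ^ 3 ≤ a ^ 3 := by gcongr
  have hm' : 2 * (m : ℝ) + 1 ≤ a ^ 13 := by
    have : (1 : ℝ) ≤ a ^ 2 := by nlinarith
    have : a ^ 13 = a ^ 11 * a ^ 2 := by ring
    nlinarith
  have hn' : (n : ℝ) ≤ (2 * m + 1) ^ d := by exact_mod_cast hn
  have h1 : (n : ℝ) ≤ a ^ (13 * d) := hn'.trans (by rw [pow_mul]; gcongr)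
  -- The factor `20` in the deviation level beats the net's `13 d` and leaves `a⁻⁴`, enough since `a
  -- δ ≥ 1` and `a ≥ 2`.
  have h4 : a ^ (13 * d) * a ^ 4 ≤ a ^ (20 * d) := by
    rw [← pow_add]; exact pow_le_pow_right₀ (by linarith) (by omega)
  rw [he, ← mul_assoc, ← div_eq_mul_inv, div_le_iff₀ (by positivity)]
  have h5 : 8 ≤ δ * a ^ 4 := by
    have : δ * a ^ 4 = (a * δ) * a ^ 3 := by ring
    nlinarith
  nlinarith [pow_pos ha0 (13 * d)]

/-- The total power appearing in the corruption term. -/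
theorem corruption_term_sq_ge {η C δ : ℝ} {d : ℕ} (hη : 0 < η) (hC : 1 ≤ C) (hd : 0 < d)
    (hδ : 0 < δ) :
    0 ≤ η ^ (1.5 : ℝ) * C ^ (2.5 : ℝ) * (d : ℝ) ^ (4.5 : ℝ) * δ ^ (-0.5 : ℝ) ∧
    η ^ 3 * C * d ^ 2 / δ ≤
      (η ^ (1.5 : ℝ) * C ^ (2.5 : ℝ) * (d : ℝ) ^ (4.5 : ℝ) * δ ^ (-0.5 : ℝ)) ^ 2 := by
  have hd1 : (1 : ℝ) ≤ d := by exact_mod_cast hd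
  refine ⟨by positivity, ?_⟩
  have hp : ∀ t s : ℝ, 0 < t → (t ^ s) ^ 2 = t ^ (s * 2) := fun t s ht => by
    rw [← Real.rpow_natCast, ← Real.rpow_mul ht.le]; norm_num
  rw [mul_pow, mul_pow, mul_pow, hp _ _ hη, hp _ _ (by linarith), hp _ _ (by linarith), hp _ _ hδ]
  have e1 : η ^ ((1.5 : ℝ) * 2) = η ^ 3 := by rw [← Real.rpow_natCast]; norm_num
  have e2 : C ^ ((2.5 : ℝ) * 2) = C ^ 5 := by rw [← Real.rpow_natCast]; norm_num
  have e3 : (d : ℝ) ^ ((4.5 : ℝ) * 2) = (d : ℝ) ^ 9 := by rw [← Real.rpow_natCast]; norm_num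
  have e4 : δ ^ ((-0.5 : ℝ) * 2) = δ⁻¹ := by rw [← Real.rpow_neg_one]; norm_num
  rw [e1, e2, e3, e4, div_eq_mul_inv]
  -- Only `C d²` is needed against the available `C⁵ d⁹`; the stated powers are not tight here.
  gcongr
  · exact le_self_pow₀ hC (by norm_num)
  · norm_num

/-! ### The probabilistic argument for a general fourth moment constant. -/

set_option maxHeartbeats 1000000 in
/-- The risk bound with a general fourth moment constant `M` in whitened coordinates. -/
theorem ridge_risk_bound_of_whitened_moment {d N : ℕ}
    (D : Measure (EuclideanSpace ℝ (Fin d) × ℝ × ℝ)) [IsProbabilityMeasure D]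
    {θ : EuclideanSpace ℝ (Fin d)} {C η ε lam δ M : ℝ}
    (hC : 1 ≤ C) (hη : 0 < η) (hlam : 0 < lam) (hδ : 0 < δ) (hδ1 : δ < 1)
    (h2 : 2 * δ ≤ d) (hθ : ‖θ‖ ≤ 1) (hx : ∀ᵐ z ∂D, ‖z.1‖ ≤ 1) (hbη : D.real {z | z.2.1 ≠ 0} ≤ η)
    (hb : ∀ᵐ z ∂D, |z.2.1| ≤ 1) (hξ : ∀ᵐ z ∂D, |z.2.2| ≤ 1)
    (hce : D[fun z => z.2.2 | MeasurableSpace.comap Prod.fst inferInstance] =ᵐ[D] 0)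
    (hhyp : ∀ v, ∫ z, inner ℝ z.1 v ^ 4 ∂D ≤ C * (∫ z, inner ℝ z.1 v ^ 2 ∂D) ^ 2)
    (hM0 : 0 < M)
    (hM : ∀ v, ∫ z, inner ℝ z.1 v ^ 4 ∂D ≤
      M * (∫ z, inner ℝ z.1 v ^ 2 ∂D + lam * ‖v‖ ^ 2) ^ 2)
    (hN : 0 < N) (hNη : 3 * Real.log (d / δ) ≤ N * η)
    (hNM : 100000 * M * (20 * d * Real.log (d / δ)) ≤ N)
    (hNε : 4 * (20 * d * Real.log (d / δ)) ≤ ε * N) :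
    1 - δ ≤ (Measure.pi fun _ : Fin N => D).real
      {z | excessRisk (D.map Prod.fst)
            (ridgeEstimator lam (fun i => (z i).1) (response θ z)) θ ≤
          8 * (ε + lam) +
            288 * η ^ (1.5 : ℝ) * C ^ (2.5 : ℝ) * (d : ℝ) ^ (4.5 : ℝ) * δ ^ (-0.5 : ℝ)} := by
  have hd : 0 < d := by
    have : (0 : ℝ) < d := by linarith
    exact_mod_cast this
  have hd1 : (1 : ℝ) ≤ d := by exact_mod_cast hd
  have hN' : (0 : ℝ) < N := by exact_mod_cast hN
  obtain ⟨a, ha⟩ : ∃ a : ℝ, a = d / δ := ⟨_, rfl⟩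
  have ha2 : 2 ≤ a := by rw [ha, le_div_iff₀ hδ]; exact h2
  have ha0 : 0 < a := by linarith
  have hda : (d : ℝ) ≤ a := by rw [ha]; exact le_div_self (by linarith) hδ hδ1.le
  have had : 1 ≤ a * δ := by rw [ha, div_mul_cancel₀ _ hδ.ne']; exact hd1
  obtain ⟨L, hL⟩ : ∃ L : ℝ, L = 20 * d * Real.log (d / δ) := ⟨_, rfl⟩
  have hL0 : 0 < L := by
    rw [hL, ← ha]
    have := Real.log_pos (by linarith : 1 < a)
    positivity
  rw [← hL] at hNM hNε
  obtain ⟨T, hT⟩ := exists_whitening (D := D) measurable_fst hx hlam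
  have hT2 : ∀ u, ∫ z, inner ℝ z.1 (T u) ^ 2 ∂D ≤ ‖u‖ ^ 2 := fun u => by
    rw [← hT]; exact le_add_of_nonneg_right (by positivity)
  have hTl : ∀ u, lam * ‖T u‖ ^ 2 ≤ ‖u‖ ^ 2 := fun u => by
    have h0 : 0 ≤ ∫ z, inner ℝ z.1 (T u) ^ 2 ∂D := integral_nonneg fun z => sq_nonneg _
    linarith [hT u]
  have hT4 : ∀ u, ∫ z, inner ℝ z.1 (T u) ^ 4 ∂D ≤ C * ‖u‖ ^ 4 := fun u => by
    refine (hhyp _).trans ?_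
    rw [show ‖u‖ ^ 4 = (‖u‖ ^ 2) ^ 2 by ring]
    have h0 : 0 ≤ ∫ z, inner ℝ z.1 (T u) ^ 2 ∂D := integral_nonneg fun z => sq_nonneg _
    have := hT2 u
    gcongr
  have hTM : ∀ u, ∫ z, inner ℝ z.1 (T u) ^ 4 ∂D ≤ M * ‖u‖ ^ 4 := fun u => by
    refine (hM _).trans ?_
    rw [hT, ← pow_mul]
  obtain ⟨i2, m2⟩ := integral_norm_sq_adjoint_le (D := D) measurable_fst hx
    (T := T.toLinearMap) hT2
  obtain ⟨i4, m4⟩ := integral_norm_pow_four_adjoint_le (D := D) measurable_fst hx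
    (T := T.toLinearMap) hT4
  -- the net
  obtain ⟨m, hmdef⟩ : ∃ m : ℕ, m = ⌈1000 * a ^ 2⌉₊ := ⟨_, rfl⟩
  have hm1 : 1000 * a ^ 2 ≤ m := by rw [hmdef]; exact Nat.le_ceil _
  have hm2 : (m : ℝ) ≤ 1001 * (d / δ) ^ 2 := by
    have := Nat.ceil_lt_add_one (by positivity : 0 ≤ 1000 * a ^ 2)
    rw [← hmdef] at this
    rw [← ha]; nlinarith
  have hm0 : 0 < m := by
    have : (0 : ℝ) < m := lt_of_lt_of_le (by positivity) hm1
    exact_mod_cast this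
  obtain ⟨S, hScard, hSnet⟩ := exists_finset_net d m hm0
  -- Markov will only bound the empirical trace by `τ = 4 a`, so the mesh must be of order `1 / a`.
  have hρle : √d / m ≤ 1 / (1000 * a) := by
    rw [div_le_div_iff₀ (by exact_mod_cast hm0) (by positivity)]
    have : √(d : ℝ) ≤ a := Real.sqrt_le_iff.2 ⟨ha0.le, by nlinarith⟩
    nlinarith
  have hρ1 : 1 / (1000 * a) ≤ 1 / 1000 := by
    apply one_div_le_one_div_of_le <;> linarith
  have hρτ : √d / m * (4 * a + 1) ≤ 1 / 100 := by
    calc √d / m * (4 * a + 1) ≤ 1 / (1000 * a) * (4 * a + 1) := by gcongr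
      _ ≤ 1 / 100 := by
        rw [one_div, inv_mul_le_iff₀ (by positivity)]; linarith
  obtain ⟨r, hr⟩ : ∃ r : ℝ, r = √(L / N) := ⟨_, rfl⟩
  have hr2 : r ^ 2 = L / N := by rw [hr, Real.sq_sqrt (by positivity)]
  have hr0 : 0 < r := by rw [hr]; positivity
  have hrN : N * r ^ 2 = L := by rw [hr2]; field_simp
  have hrM : M * r ^ 2 ≤ 1 / 100000 := by
    rw [hr2, mul_div_assoc', div_le_iff₀ hN']; linarith
  have hrε : r ^ 2 ≤ ε / 4 := by
    rw [hr2, div_le_iff₀ hN']; linarith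
  -- the exceptional events
  let μ := Measure.pi fun _ : Fin N => D
  let Elow : EuclideanSpace ℝ (Fin d) → Set (Fin N → EuclideanSpace ℝ (Fin d) × ℝ × ℝ) := fun w =>
    {z | ‖w‖ ≤ 2 ∧ (N : ℝ)⁻¹ * ∑ i, inner ℝ (z i).1 (T w) ^ 2 + lam * ‖T w‖ ^ 2 < ‖w‖ ^ 2 - 1 / 50}
  let Enoise : EuclideanSpace ℝ (Fin d) → Set (Fin N → EuclideanSpace ℝ (Fin d) × ℝ × ℝ) := fun w =>
    {z | r * ((N : ℝ)⁻¹ * (∑ i, inner ℝ (z i).1 (T w) ^ 2) / 2 + 1) <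
      (N : ℝ)⁻¹ * ∑ i, (z i).2.2 * inner ℝ (z i).1 (T w)}
  let E2 : Set (Fin N → EuclideanSpace ℝ (Fin d) × ℝ × ℝ) :=
    {z | N * (d / (δ / 4)) ≤ ∑ i, ‖T.toLinearMap.adjoint (z i).1‖ ^ 2}
  let E4 : Set (Fin N → EuclideanSpace ℝ (Fin d) × ℝ × ℝ) :=
    {z | N * (C * d ^ 2 / (δ / 4)) ≤ ∑ i, ‖T.toLinearMap.adjoint (z i).1‖ ^ 4}
  let Eb : Set (Fin N → EuclideanSpace ℝ (Fin d) × ℝ × ℝ) :=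
    {z | N * (4 * η) ≤
      ∑ i, {z : EuclideanSpace ℝ (Fin d) × ℝ × ℝ | z.2.1 ≠ 0}.indicator (fun _ => (1 : ℝ)) (z i)}
  have plow : ∀ w, μ.real (Elow w) ≤ Real.exp (-L) := fun w => by
    by_cases hw : ‖w‖ ≤ 2
    swap
    · have : Elow w = ∅ := Set.eq_empty_of_forall_notMem fun z hz => hw hz.1
      rw [this, measureReal_empty]; positivity
    have hV : ∫ z, (inner ℝ z.1 (T w) ^ 2) ^ 2 ∂D ≤ M * 16 := by
      simp only [← pow_mul]
      refine (hTM w).trans ?_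
      have : ‖w‖ ^ 4 ≤ 2 ^ 4 := by gcongr
      gcongr; linarith
    -- With `s = 1/(1000 M)` the variance loss is `8/1000` and the deviation loss `1000 M r² ≤
    -- 1/100`, together below `1/50`.
    have := measureReal_pi_sum_le_le_exp (D := D)
      (f := fun z => inner ℝ z.1 (T w) ^ 2) (by fun_prop) (fun z => sq_nonneg _)
      (integrable_inner_pow measurable_fst hx (T w) 2)
      (by simpa only [← pow_mul] using integrable_inner_pow measurable_fst hx (T w) (2 * 2))
      (s := 1 / (1000 * M)) (by positivity) hV N L
    refine (measureReal_mono fun z hz => ?_).trans this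
    have h1 : (N : ℝ)⁻¹ * ∑ i, inner ℝ (z i).1 (T w) ^ 2 ≤
        ∫ z, inner ℝ z.1 (T w) ^ 2 ∂D - 1 / 50 := by
      have h3 := hz.2
      rw [← hT w] at h3
      linarith
    rw [inv_mul_le_iff₀ hN'] at h1
    refine h1.trans ?_
    have h4 : 1 / (1000 * M) * (M * 16) / 2 = 8 / 1000 := by field_simp; norm_num
    have h5 : L / (1 / (1000 * M)) = N * (1000 * (M * r ^ 2)) := by
      rw [← hrN]; field_simp
    rw [h4, h5, ← mul_sub]
    exact mul_le_mul_of_nonneg_left (by linarith) hN'.le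
  have pnoise : ∀ w, μ.real (Enoise w) ≤ Real.exp (-L) := fun w => by
    have := measureReal_pi_noise_le_exp (D := D)
      (m := MeasurableSpace.comap Prod.fst inferInstance) measurable_fst.comap_le
      (ξ := fun z => z.2.2) (by fun_prop) hξ hce (f := fun z => r * inner ℝ z.1 (T w))
      (by
        have h1 : Measurable fun x : EuclideanSpace ℝ (Fin d) => r * inner ℝ x (T w) := by fun_prop
        exact h1.comp (comap_measurable Prod.fst)) N L
    refine (measureReal_mono fun z hz => ?_).trans this
    have h1 : r * ((N : ℝ)⁻¹ * (∑ i, inner ℝ (z i).1 (T w) ^ 2) / 2 + 1) <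
      (N : ℝ)⁻¹ * ∑ i, (z i).2.2 * inner ℝ (z i).1 (T w) := hz
    have h3 := mul_lt_mul_of_pos_left h1 (mul_pos hN' hr0)
    have h4 : ∑ i, (r * inner ℝ (z i).1 (T w) * (z i).2.2 - (r * inner ℝ (z i).1 (T w)) ^ 2 / 2) =
        r * ∑ i, (z i).2.2 * inner ℝ (z i).1 (T w) -
          r ^ 2 * (∑ i, inner ℝ (z i).1 (T w) ^ 2) / 2 := by
      rw [Finset.sum_sub_distrib, Finset.mul_sum, Finset.mul_sum, Finset.sum_div]
      congr 1 <;> exact Finset.sum_congr rfl fun i _ => by ring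
    show L ≤ ∑ i, (r * inner ℝ (z i).1 (T w) * (z i).2.2 - (r * inner ℝ (z i).1 (T w)) ^ 2 / 2)
    rw [h4]
    have h5 : N * r * (r * ((N : ℝ)⁻¹ * (∑ i, inner ℝ (z i).1 (T w) ^ 2) / 2 + 1)) =
        r ^ 2 * (∑ i, inner ℝ (z i).1 (T w) ^ 2) / 2 + L := by
      rw [← hrN]; field_simp
    have h6 : N * r * ((N : ℝ)⁻¹ * ∑ i, (z i).2.2 * inner ℝ (z i).1 (T w)) =
        r * ∑ i, (z i).2.2 * inner ℝ (z i).1 (T w) := by field_simp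
    linarith
  have p2 : μ.real E2 ≤ δ / 4 := measureReal_pi_le_sum_le_div
    (ae_of_all _ fun z => by positivity) i2 hN m2 (by linarith) (by linarith)
  have p4 : μ.real E4 ≤ δ / 4 := measureReal_pi_le_sum_le_div
    (ae_of_all _ fun z => by positivity) i4 hN m4 (by positivity) (by linarith)
  have pb : μ.real Eb ≤ δ / 4 := by
    refine (measureReal_pi_four_mul_le_sum_indicator (D := D)
      ((measurableSet_singleton (0 : ℝ)).compl.preimage (measurable_fst.comp measurable_snd))
      hbη hη N).trans ?_
    have h1 : Real.exp (-(N * η)) ≤ (a ^ 3)⁻¹ := by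
      rw [← Real.exp_log (by positivity : 0 < a ^ 3), ← Real.exp_neg, Real.log_pow]
      refine Real.exp_le_exp.2 (neg_le_neg ?_)
      rw [ha]; exact_mod_cast hNη
    refine h1.trans ?_
    rw [inv_le_iff_one_le_mul₀ (by positivity)]
    have : δ / 4 * a ^ 3 = (a * δ) * (a ^ 2 / 4) := by ring
    nlinarith
  have pnet : μ.real (⋃ w ∈ S, (Elow w ∪ Enoise w)) ≤ δ / 4 := by
    refine (measureReal_biUnion_finset_le _ _).trans ?_
    refine (Finset.sum_le_sum (g := fun _ => 2 * Real.exp (-L)) fun w _ => ?_).trans ?_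
    · linarith [measureReal_union_le (μ := μ) (Elow w) (Enoise w), plow w, pnoise w]
    · rw [Finset.sum_const, nsmul_eq_mul, hL]
      exact net_card_mul_exp_neg_le hd hδ h2 hm2 hScard
  -- Net, trace, fourth moment and corruption count each fail with probability at most `δ / 4`.
  refine one_sub_le_measureReal_of_ae (B := (⋃ w ∈ S, (Elow w ∪ Enoise w)) ∪ E2 ∪ E4 ∪ Eb) ?_ ?_
  swap
  · have q1 := measureReal_union_le (μ := μ) ((⋃ w ∈ S, (Elow w ∪ Enoise w)) ∪ E2 ∪ E4) Eb
    have q2 := measureReal_union_le (μ := μ) ((⋃ w ∈ S, (Elow w ∪ Enoise w)) ∪ E2) E4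
    have q3 := measureReal_union_le (μ := μ) (⋃ w ∈ S, (Elow w ∪ Enoise w)) E2
    linarith
  have hball : ∀ᵐ z ∂μ, ∀ i, |(z i).2.1| ≤ 1 := ae_all_iff.2 fun i =>
    (measurePreserving_eval (fun _ : Fin N => D) i).quasiMeasurePreserving.ae hb
  filter_upwards [hball] with z hbz hz
  simp only [Set.mem_union, not_or, Set.mem_iUnion, not_exists] at hz
  obtain ⟨⟨⟨hznet, hz2⟩, hz4⟩, hzb⟩ := hz
  have hz2' : ∑ i, ‖T.toLinearMap.adjoint (z i).1‖ ^ 2 < N * (d / (δ / 4)) := not_le.1 hz2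
  have hz4' : ∑ i, ‖T.toLinearMap.adjoint (z i).1‖ ^ 4 < N * (C * d ^ 2 / (δ / 4)) := not_le.1 hz4
  have hzb' : ∑ i, {z : EuclideanSpace ℝ (Fin d) × ℝ × ℝ | z.2.1 ≠ 0}.indicator
      (fun _ => (1 : ℝ)) (z i) < N * (4 * η) := not_le.1 hzb
  have key := ridgeEstimator_error_whitened_le hlam hN hθ z T hTl (S := (S : Set _))
    (ρ := √d / m) (τ := 4 * a) (r := r) hSnet
    (fun w hw hw2 => by
      by_contra hcon
      exact (hznet w hw).1 ⟨hw2, not_le.1 hcon⟩)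
    (fun w hw hw2 => by
      by_contra hcon
      exact (hznet w hw).2 (not_le.1 hcon))
    (by
      rw [inv_mul_le_iff₀ hN']
      refine hz2'.le.trans_eq ?_
      rw [ha]; field_simp)
    (by positivity) (hρle.trans hρ1) hρτ hr0.le
  obtain ⟨β, hβ⟩ : ∃ β : ℝ, β = (N : ℝ)⁻¹ * ∑ i, |(z i).2.1| * ‖T.toLinearMap.adjoint (z i).1‖ :=
    ⟨_, rfl⟩
  obtain ⟨e, he⟩ : ∃ e, e = ridgeEstimator lam (fun i => (z i).1) (response θ z) - θ := ⟨_, rfl⟩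
  rw [← he, ← hβ] at key
  have hβ0 : 0 ≤ β := by rw [hβ]; positivity
  have hβ4 : β ^ 4 ≤ 256 * (η ^ 3 * C * d ^ 2 / δ) := by
    have h1 := avg_abs_mul_pow_four_le (fun i => (z i).2.1)
      (fun i => ‖T.toLinearMap.adjoint (z i).1‖) hbz fun i => norm_nonneg _
    rw [← hβ] at h1
    have h3 : (N : ℝ)⁻¹ * ∑ i, (if (z i).2.1 ≠ 0 then (1 : ℝ) else 0) ≤ 4 * η := by
      rw [inv_mul_le_iff₀ hN']
      refine le_trans (le_of_eq ?_) hzb'.le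
      exact Finset.sum_congr rfl fun i _ => by simp [Set.indicator_apply]
    have h4 : (N : ℝ)⁻¹ * ∑ i, ‖T.toLinearMap.adjoint (z i).1‖ ^ 4 ≤ C * d ^ 2 / (δ / 4) := by
      rw [inv_mul_le_iff₀ hN']; exact hz4'.le
    have h5 : 0 ≤ (N : ℝ)⁻¹ * ∑ i, (if (z i).2.1 ≠ 0 then (1 : ℝ) else 0) :=
      mul_nonneg (by positivity) (Finset.sum_nonneg fun i _ => by split_ifs <;> norm_num)
    calc β ^ 4 ≤ (4 * η) ^ 3 * (C * d ^ 2 / (δ / 4)) := h1.trans (by gcongr)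
      _ = _ := by field_simp; ring
  obtain ⟨hW0, hW⟩ := corruption_term_sq_ge hη hC hd hδ
  show excessRisk _ _ _ ≤ _
  rw [show 288 * η ^ (1.5 : ℝ) * C ^ (2.5 : ℝ) * (d : ℝ) ^ (4.5 : ℝ) * δ ^ (-0.5 : ℝ) =
    288 * (η ^ (1.5 : ℝ) * C ^ (2.5 : ℝ) * (d : ℝ) ^ (4.5 : ℝ) * δ ^ (-0.5 : ℝ)) by ring]
  generalize η ^ (1.5 : ℝ) * C ^ (2.5 : ℝ) * (d : ℝ) ^ (4.5 : ℝ) * δ ^ (-0.5 : ℝ) = W at hW0 hW ⊢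
  have hβ2 : β ^ 2 ≤ 16 * W := by
    refine le_of_sq_le_sq ?_ (by positivity)
    nlinarith
  have hrisk : excessRisk (D.map Prod.fst)
      (ridgeEstimator lam (fun i => (z i).1) (response θ z)) θ ≤ ‖T.symm e‖ ^ 2 := by
    rw [excessRisk, ← he, integral_map measurable_fst.aemeasurable (by fun_prop)]
    simp only [real_inner_comm _ e]
    simpa using hT2 (T.symm e)
  refine hrisk.trans ?_
  have h7 : ‖T.symm e‖ ^ 2 ≤ (6 / 5 * (β + √lam + 2 * r)) ^ 2 := by gcongr
  have h8 := Real.sq_sqrt hlam.le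
  -- The square of the sum is at most `(6/5)² · 3 (β² + λ + 4 r²)`, with `β² ≤ 16 W`, `4 r² ≤ ε` and
  -- `(6/5)² · 3 < 8`.
  nlinarith [sq_nonneg (β - √lam), sq_nonneg (β - 2 * r), sq_nonneg (√lam - 2 * r)]

/-! ### The main theorem: choice of the fourth moment constant. -/

/-- `D` is the law of one triple `(x, b, ξ)`; the data are `N` i.i.d. triples, that is, a point `z`
of the product space under the product measure. -/
theorem mainTheorem3 :
    ∃ K : ℝ, 0 < K ∧
      ∀ (d N : ℕ) (D : Measure (EuclideanSpace ℝ (Fin d) × ℝ × ℝ)) [IsProbabilityMeasure D]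
        (θ : EuclideanSpace ℝ (Fin d)) (C η ε lam δ : ℝ),
        1 ≤ C → 0 < η → 0 < ε → 0 < lam → 0 < δ → δ < 1 → 2 * δ ≤ (d : ℝ) →
        -- normalization of the parameter and of the features
        ‖θ‖ ≤ 1 →
        (∀ᵐ z ∂D, ‖z.1‖ ≤ 1) →
        -- sparse bounded bias
        D.real {z | z.2.1 ≠ 0} ≤ η →
        (∀ᵐ z ∂D, |z.2.1| ≤ 1) →
        -- bounded noise with mean zero given the feature
        (∀ᵐ z ∂D, |z.2.2| ≤ 1) →
        D[fun z => z.2.2 | MeasurableSpace.comap Prod.fst inferInstance] =ᵐ[D] 0 →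
        IsHypercontractive C (D.map Prod.fst) →
        -- sample size
        K * (((d : ℝ) / ε ^ 2 + 1 / η) * Real.log ((d : ℝ) / δ) + 1 / δ) ≤ (N : ℝ) →
        (ε ≤ lam ∨ K * (C * (d : ℝ) * Real.log ((d : ℝ) / δ)) ≤ (N : ℝ)) →
        1 - δ ≤ (Measure.pi fun _ : Fin N => D).real
          {z | excessRisk (D.map Prod.fst)
                (ridgeEstimator lam (fun i => (z i).1) (response θ z)) θ ≤
              8 * (ε + lam) +
                288 * η ^ (1.5 : ℝ) * C ^ (2.5 : ℝ) * (d : ℝ) ^ (4.5 : ℝ) * δ ^ (-0.5 : ℝ)} := by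
  refine ⟨10 ^ 7, by norm_num, ?_⟩
  intro d N D _ θ C η ε lam δ hC hη hε hlam hδ hδ1 h2 hθ hx hbη hb hξ hce hhyp hNK hcase
  have hd0 : (0 : ℝ) < d := by linarith
  have hlog : 0 < Real.log (d / δ) := Real.log_pos (by
    have : (2 : ℝ) ≤ d / δ := by rw [le_div_iff₀ hδ]; exact h2
    linarith)
  obtain ⟨A, hA⟩ : ∃ A : ℝ, A = d * Real.log (d / δ) := ⟨_, rfl⟩
  have hA0 : 0 < A := by rw [hA]; positivity
  have e1 : 10 ^ 7 * (((d : ℝ) / ε ^ 2 + 1 / η) * Real.log (d / δ) + 1 / δ) =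
      10 ^ 7 * (A / ε ^ 2) + 10 ^ 7 * (Real.log (d / δ) / η) + 10 ^ 7 * (1 / δ) := by
    rw [hA]; ring
  rw [e1] at hNK
  have p1 : 0 < A / ε ^ 2 := by positivity
  have p2 : 0 < Real.log (d / δ) / η := by positivity
  have p3 : 0 < 1 / δ := by positivity
  have hN' : (0 : ℝ) < N := by linarith
  have hN : 0 < N := by exact_mod_cast hN'
  have hNη : 3 * Real.log (d / δ) ≤ N * η := by
    have : Real.log (d / δ) / η * 3 ≤ N := by linarith
    have h3 := mul_le_mul_of_nonneg_right this hη.le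
    rw [mul_right_comm, div_mul_cancel₀ _ hη.ne'] at h3
    linarith
  have hNA : 10 ^ 7 * (A / ε ^ 2) ≤ N := by linarith
  -- The sample size only gives `ε N ≳ A / ε`, which dominates `A` when `ε ≤ 1`; larger `ε` is
  -- treated separately.
  have hNε1 : ε ≤ 1 → 4 * (20 * d * Real.log (d / δ)) ≤ ε * N := fun h1 => by
    have h3 : 80 * (A / ε ^ 2) ≤ N := by linarith
    have h4 := mul_le_mul_of_nonneg_left h3 hε.le
    have h5 : A ≤ ε * (A / ε ^ 2) := by
      have : ε * (A / ε ^ 2) = A / ε := by field_simp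
      rw [this]; exact le_div_self hA0.le hε h1
    rw [mul_assoc 20, ← hA]
    linarith
  have hhyp' : ∀ v, ∫ z, inner ℝ z.1 v ^ 4 ∂D ≤ C * (∫ z, inner ℝ z.1 v ^ 2 ∂D) ^ 2 := fun v => by
    have := (hhyp v).2
    rwa [integral_map measurable_fst.aemeasurable (by fun_prop),
      integral_map measurable_fst.aemeasurable (by fun_prop)] at this
  -- Here the target is at least `16`, while the error has norm at most `3` and hence risk at most
  -- `9`.
  by_cases htriv : ε ≤ lam ∧ 1 ≤ ε
  · refine one_sub_le_measureReal_of_ae (B := ∅) ?_ (by simpa using hδ.le)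
    have hall : ∀ {p : EuclideanSpace ℝ (Fin d) × ℝ × ℝ → Prop}, (∀ᵐ z ∂D, p z) →
        ∀ᵐ z ∂(Measure.pi fun _ : Fin N => D), ∀ i, p (z i) := fun hp => ae_all_iff.2 fun i =>
      (measurePreserving_eval (fun _ : Fin N => D) i).quasiMeasurePreserving.ae hp
    filter_upwards [hall hx, hall hb, hall hξ] with z hxz hbz hξz _
    have h3 := ridgeEstimator_error_norm_le_three (htriv.2.trans htriv.1) hN hθ z hxz hbz hξz
    have h4 : excessRisk (D.map Prod.fst)
        (ridgeEstimator lam (fun i => (z i).1) (response θ z)) θ ≤ 3 ^ 2 := by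
      rw [excessRisk, integral_map measurable_fst.aemeasurable (by fun_prop)]
      refine (integral_mono_of_nonneg (ae_of_all _ fun _ => sq_nonneg _)
        (integrable_const ((3 : ℝ) ^ 2)) ?_).trans (by simp)
      filter_upwards [ae_abs_inner_le hx
        (ridgeEstimator lam (fun i => (z i).1) (response θ z) - θ)] with y hy
      rw [real_inner_comm]
      exact sq_le_sq' (neg_le_of_abs_le (hy.trans h3)) (le_of_abs_le (hy.trans h3))
    obtain ⟨hW0, -⟩ := corruption_term_sq_ge hη hC (by exact_mod_cast hd0 : 0 < d) hδ
    show excessRisk _ _ _ ≤ _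
    linarith [htriv.1, htriv.2]
  by_cases h1 : ε ≤ lam
  · have hε1 : ε ≤ 1 := le_of_not_ge fun h => htriv ⟨h1, h⟩
    refine ridge_risk_bound_of_whitened_moment D (M := 1 / ε ^ 2) hC hη hlam hδ hδ1 h2 hθ hx hbη
      hb hξ hce hhyp' (by positivity) (fun v => ?_) hN hNη ?_ (hNε1 hε1)
    -- Since `ε ≤ λ`, the ridge part alone gives `‖v‖⁴ ≤ ε⁻² (λ‖v‖²)²`.
    · have h3 : ∫ z, inner ℝ z.1 v ^ 4 ∂D ≤ ‖v‖ ^ 4 := by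
        refine (integral_mono_of_nonneg (ae_of_all _ fun _ => by positivity)
          (integrable_const (‖v‖ ^ 4)) ?_).trans (by simp)
        filter_upwards [ae_abs_inner_le hx v] with z hz
        rw [← Even.pow_abs (by decide : Even 4)]
        gcongr
      have h0 : 0 ≤ ∫ z, inner ℝ z.1 v ^ 2 ∂D := integral_nonneg fun z => sq_nonneg _
      rw [one_div, ← div_eq_inv_mul, le_div_iff₀ (by positivity)]
      calc _ ≤ ‖v‖ ^ 4 * ε ^ 2 := by gcongr
        _ = (0 + ε * ‖v‖ ^ 2) ^ 2 := by ring
        _ ≤ _ := by gcongr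
    · have : 100000 * (1 / ε ^ 2) * (20 * d * Real.log (d / δ)) = 2000000 * (A / ε ^ 2) := by
        rw [hA]; ring
      rw [this]; linarith
  · have h3 := hcase.resolve_left h1
    rw [mul_assoc C, ← hA] at h3
    refine ridge_risk_bound_of_whitened_moment D (M := C) hC hη hlam hδ hδ1 h2 hθ hx hbη
      hb hξ hce hhyp' (by linarith) (fun v => (hhyp' v).trans ?_) hN hNη ?_ ?_
    · have h0 : 0 ≤ ∫ z, inner ℝ z.1 v ^ 2 ∂D := integral_nonneg fun z => sq_nonneg _
      gcongr
      exact le_add_of_nonneg_right (by positivity)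
    · have h4 : 0 < C * A := by positivity
      rw [mul_assoc 20, ← hA]
      linarith
    -- For `ε ≥ 1` the second sample size condition already yields `N ≳ C A ≥ A`.
    · rcases le_total ε 1 with h4 | h4
      · exact hNε1 h4
      · rw [mul_assoc 20, ← hA]
        nlinarith
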